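/- There is an absolute constant $C$, a deterministic LOCAL algorithm $\mathcal A$ and a function $T(n,\delta,r)$ with $$T(n,\delta,r)\le C\cdot\max\{1,\log_{\delta/r} n\}\qquad\text{for all integers } n\ge 1,\ \delta>r\ge 1,$$ such that the following holds for all integers $n\ge 1$ and $\delta>r\ge 1$. Let $G=(V,E)$ be a finite multihypergraph (each hyperedge is a nonempty set of nodes; parallel hyperedges are allowed) with $n$ nodes in which every node lies in at least $\delta$ hyperedges (counted with multiplicity) and every hyperedge contains at most $r$ nodes. Then $\mathcal A$, run on $G$ for $T(n,\delta,r)$ rounds, computes a hypergraph sinkless orientation of $G$, that is, it orients every hyperedge such that each hyperedge is outgoing for exactly one of its nodes and incoming for all others, and each node has at least one outgoing hyperedge. Here the LOCAL model on $G$ is the LOCAL model on the bipartite graph with node set $V\sqcup E$ in which $v\in V$ and $e\in E$ are adjacent if and only if $v\in e$. Nodes and hyperedges have arbitrary pairwise distinct natural numbers as identifiers and an arbitrary numbering of their neighbors by ports; initially each of them knows only its identifier, its degree, whether it is a node or a hyperedge of $G$, and the numbers $n,\delta,r$. In each synchronous round each of them sends one message (of unbounded size) to each of its neighbors, receives the messages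 sent to it, and performs an arbitrary deterministic local computation. At the end, for every incident pair $v\in e$, both $v$ and $e$ output whether $e$ is outgoing for $v$. -/

import Mathlib

/-- A multihypergraph with vertex set `V`: the hyperedges are indexed by `E`, and distinct
indices may have the same set of endpoints (parallel hyperedges). -/
structure MultiHypergraph (V E : Type*) where
  /-- the set of nodes contained in a hyperedge -/
  ends : E → Finset V
  /-- every hyperedge contains at least one node -/
  ends_nonempty : ∀ e, (ends e).Nonempty

namespace MultiHypergraph

variable {V E : Type*}

/-- The degree of a node: the number of incident hyperedges, counted with multiplicity. -/
noncomputable def degree (G : MultiHypergraph V E) (v : V) : ℕ :=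
  {e : E | v ∈ G.ends e}.ncard

/-- The rank of a hyperedge: the number of nodes that it contains. -/
def rank (G : MultiHypergraph V E) (e : E) : ℕ := (G.ends e).card

/-- The bipartite representation of a multihypergraph: the simple graph on the nodes and the
hyperedges in which a node and a hyperedge are adjacent iff the node lies in the hyperedge. -/
def bipartite (G : MultiHypergraph V E) : SimpleGraph (V ⊕ E) where
  Adj x y := (∃ v e, x = .inl v ∧ y = .inr e ∧ v ∈ G.ends e) ∨
    (∃ v e, x = .inr e ∧ y = .inl v ∧ v ∈ G.ends e)
  symm := ⟨by
    rintro x y (⟨v, e, hx, hy, h⟩ | ⟨v, e, hx, hy, h⟩)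
    · exact Or.inr ⟨v, e, hy, hx, h⟩
    · exact Or.inl ⟨v, e, hy, hx, h⟩⟩
  loopless := ⟨by
    rintro x (⟨v, e, hx, hy, -⟩ | ⟨v, e, hx, hy, -⟩) <;> simp [hx] at hy⟩

theorem bipartite_adj (G : MultiHypergraph V E) {v : V} {e : E} (h : v ∈ G.ends e) :
    G.bipartite.Adj (.inl v) (.inr e) :=
  Or.inl ⟨v, e, rfl, rfl, h⟩

/-- A hypergraph sinkless orientation. An orientation makes each hyperedge `e` outgoing for
exactly one of its nodes, `out e`, and incoming for all others; it is sinkless if every node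
has at least one outgoing hyperedge. -/
def IsHSO (G : MultiHypergraph V E) (out : E → V) : Prop :=
  (∀ e, out e ∈ G.ends e) ∧ ∀ v, ∃ e, out e = v

end MultiHypergraph

/-- A port numbering of a (locally finite) graph: the neighbors of a node `w` are numbered by
the ports `0, …, deg w - 1` of `w`, where `deg w` is the degree of `w`. -/
structure PortNumbering {W : Type*} (H : SimpleGraph W) where
  deg : W → ℕ
  port : ∀ w, Fin (deg w) ≃ H.neighborSet w

/-- A deterministic algorithm in the LOCAL model, for nodes that get a local input in `Inp` and
that put a label in `Out` on each of their ports. Local computation and message size are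
unrestricted. The natural number `d` is the degree of the node that executes the step. -/
structure LocalAlgorithm (Inp Out : Type) where
  /-- the possible states of a node -/
  State : Type
  /-- the possible messages -/
  Msg : Type
  /-- the initial state, from the degree, the identifier and the local input of the node -/
  start : (d : ℕ) → (ident : ℕ) → Inp → State
  /-- the message that a node sends through each of its ports in a round -/
  send : (d : ℕ) → State → Fin d → Msg
  /-- the new state, from the old one and the messages that arrived through the ports -/
  receive : (d : ℕ) → State → (Fin d → Msg) → State
  /-- the output of a node at each of its ports -/
  output : (d : ℕ) → State → Fin d → Out

namespace LocalAlgorithm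

/-- The state of the node `w` after `t` synchronous rounds of the algorithm on the graph `H`:
in each round every node sends one message to each neighbor, receives the messages that its
neighbors sent to it, and updates its state. -/
def stateAfter {Inp Out : Type} (A : LocalAlgorithm Inp Out) {W : Type*} {H : SimpleGraph W}
    (P : PortNumbering H) (ident : W → ℕ) (inp : W → Inp) : ℕ → W → A.State
  | 0, w => A.start (P.deg w) (ident w) (inp w)
  | t + 1, w => A.receive (P.deg w) (stateAfter A P ident inp t w) fun i =>
      A.send (P.deg (P.port w i)) (stateAfter A P ident inp t (P.port w i))
        ((P.port (P.port w i)).symm ⟨w, (P.port w i).2.symm⟩)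

/-- The output of the node `w` for its neighbor `u` after `t` rounds. -/
def outputAfter {Inp Out : Type} (A : LocalAlgorithm Inp Out) {W : Type*} {H : SimpleGraph W}
    (P : PortNumbering H) (ident : W → ℕ) (inp : W → Inp) (t : ℕ) (w u : W)
    (h : H.Adj w u) : Out :=
  A.output (P.deg w) (A.stateAfter P ident inp t w) ((P.port w).symm ⟨u, h⟩)

end LocalAlgorithm

/-- What a node of the bipartite representation knows initially, besides its degree and its
identifier: the three global parameters and the side that it is on. -/
structure HypergraphInput where
  numNodes : ℕ
  minDegree : ℕ
  maxRank : ℕ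
  isVertex : Bool

/-- The algorithm `A`, run for `t` rounds on the bipartite representation of `G` with the given
global parameters, port numbering and identifiers, computes a hypergraph sinkless orientation:
for each node `v` and each hyperedge `e` that contains `v`, both `v` and `e` output whether `e`
is outgoing for `v`. -/
def LocalAlgorithm.ComputesHSO (A : LocalAlgorithm HypergraphInput Bool) {V E : Type*}
    (G : MultiHypergraph V E) (n δ r t : ℕ) (P : PortNumbering G.bipartite)
    (ident : V ⊕ E → ℕ) : Prop :=
  ∃ out : E → V, G.IsHSO out ∧ ∀ (v : V) (e : E) (h : v ∈ G.ends e),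
    (A.outputAfter P ident (fun w => ⟨n, δ, r, w.isLeft⟩) t (.inl v) (.inr e)
      (G.bipartite_adj h) = true ↔ out e = v) ∧
    (A.outputAfter P ident (fun w => ⟨n, δ, r, w.isLeft⟩) t (.inr e) (.inl v)
      (G.bipartite_adj h).symm = true ↔ out e = v)

/-! Call a set of whole hyperedges matchable if its nodes can be matched injectively to its
hyperedges. A candidate is a matchable set inside some ball of radius `k`. Each node selects, among
the candidates containing it, the one of least code, and takes the hyperedge assigned by that
candidate's canonical matching. Apart from membership, being a candidate does not depend on the
selecting node, so two nodes selecting the same hyperedge share the same candidate, and injectivity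
forbids a conflict (`Picks.unique`). Hyperedges selected by nobody go to their node of least
identifier.

Every node `a` has a candidate if `(δ/r)^k > n` (`exists_isCandidate`). Let `L` be a largest
matchable set in the ball around `a`, and suppose that it misses `a`. By a Hall argument
(`exists_subset_matching`), any nonempty set `F` of hyperedges in the ball outside `L` has more than
`|F|` nodes outside `L`; otherwise part of `F` could be added. A set of nodes `W` outside `L` meets
at least `|W|δ/r` hyperedges, none of them in `L`. Iterating from `{a}` thus multiplies the number
of nodes by at least `δ/r` per step, exceeding `n` after `k` steps.

All choices depend only on balls of radius `2k+1`, so gathering neighborhoods for `O(k)` rounds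
suffices. -/

/-! ### Incidence sets and distances -/

/-- The hyperedges of an incidence set that contain one of the given nodes. -/
def incidentEdges (K : Finset (ℕ × ℕ)) (W : Finset ℕ) : Finset ℕ :=
  (K.filter fun p => p.1 ∈ W).image Prod.snd

/-- The nodes contained in one of the given hyperedges. -/
def incidentNodes (K : Finset (ℕ × ℕ)) (F : Finset ℕ) : Finset ℕ :=
  (K.filter fun p => p.2 ∈ F).image Prod.fst

theorem mem_incidentEdges {K : Finset (ℕ × ℕ)} {W : Finset ℕ} {b : ℕ} :
    b ∈ incidentEdges K W ↔ ∃ a ∈ W, (a, b) ∈ K := by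
  simp only [incidentEdges, Finset.mem_image, Finset.mem_filter, Prod.exists]
  constructor
  · rintro ⟨x, y, ⟨h, hx⟩, rfl⟩
    exact ⟨x, hx, h⟩
  · rintro ⟨x, hx, h⟩
    exact ⟨x, b, ⟨h, hx⟩, rfl⟩

theorem mem_incidentNodes {K : Finset (ℕ × ℕ)} {F : Finset ℕ} {a : ℕ} :
    a ∈ incidentNodes K F ↔ ∃ b ∈ F, (a, b) ∈ K := by
  simp only [incidentNodes, Finset.mem_image, Finset.mem_filter, Prod.exists]
  constructor
  · rintro ⟨x, y, ⟨h, hx⟩, rfl⟩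
    exact ⟨y, hx, h⟩
  · rintro ⟨x, hx, h⟩
    exact ⟨a, x, ⟨h, hx⟩, rfl⟩

theorem mem_image_fst {K : Finset (ℕ × ℕ)} {a : ℕ} :
    a ∈ K.image Prod.fst ↔ ∃ b, (a, b) ∈ K := by simp

theorem mem_image_snd {K : Finset (ℕ × ℕ)} {b : ℕ} :
    b ∈ K.image Prod.snd ↔ ∃ a, (a, b) ∈ K := by simp

/-- Two nodes are equal or lie in a common hyperedge. -/
def Near (K : Finset (ℕ × ℕ)) (x y : ℕ) : Prop :=
  x = y ∨ ∃ b, (x, b) ∈ K ∧ (y, b) ∈ K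

/-- The node `y` can be reached from the node `x` through at most `k` hyperedges. -/
def Reach (K : Finset (ℕ × ℕ)) : ℕ → ℕ → ℕ → Prop
  | 0, x, y => x = y
  | k + 1, x, y => ∃ z, Near K x z ∧ Reach K k z y

theorem Near.symm {K : Finset (ℕ × ℕ)} {x y : ℕ} (h : Near K x y) : Near K y x := by
  rcases h with h | ⟨b, h, h'⟩
  · exact Or.inl h.symm
  · exact Or.inr ⟨b, h', h⟩

theorem Reach.refl (K : Finset (ℕ × ℕ)) (k x : ℕ) : Reach K k x x := by
  induction k with
  | zero => rfl
  | succ k ih => exact ⟨x, Or.inl rfl, ih⟩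

theorem Near.reach {K : Finset (ℕ × ℕ)} {x y : ℕ} (h : Near K x y) : Reach K 1 x y :=
  ⟨y, h, rfl⟩

theorem Reach.trans {K : Finset (ℕ × ℕ)} {j k x y z : ℕ} (h : Reach K j x y)
    (h' : Reach K k y z) : Reach K (j + k) x z := by
  induction j generalizing x with
  | zero => cases h; simpa using h'
  | succ j ih =>
    obtain ⟨u, hu, hu'⟩ := h
    rw [Nat.add_right_comm]
    exact ⟨u, hu, ih hu'⟩

theorem Reach.symm {K : Finset (ℕ × ℕ)} {k x y : ℕ} (h : Reach K k x y) : Reach K k y x := by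
  induction k generalizing x with
  | zero => exact Eq.symm h
  | succ k ih =>
    obtain ⟨u, hu, hu'⟩ := h
    exact (ih hu').trans hu.symm.reach

theorem Reach.mono {K : Finset (ℕ × ℕ)} {j k x y : ℕ} (h : Reach K j x y) (hjk : j ≤ k) :
    Reach K k x y := by
  obtain ⟨i, rfl⟩ := Nat.exists_eq_add_of_le hjk
  exact h.trans (Reach.refl K i y)

theorem Reach.mono_left {K K' : Finset (ℕ × ℕ)} (hK : K ⊆ K') {k x y : ℕ} (h : Reach K k x y) :
    Reach K' k x y := by
  induction k generalizing x with
  | zero => exact h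
  | succ k ih =>
    obtain ⟨u, hu, hu'⟩ := h
    refine ⟨u, ?_, ih hu'⟩
    rcases hu with hu | ⟨b, h1, h2⟩
    · exact Or.inl hu
    · exact Or.inr ⟨b, hK h1, hK h2⟩

/-! ### Candidates and the orientation they induce -/

/-- `f` matches the nodes of `L` to pairwise distinct hyperedges of `L`. -/
def IsMatchingOf (L : Finset (ℕ × ℕ)) (f : ℕ → ℕ) : Prop :=
  Set.InjOn f (L.image Prod.fst) ∧ ∀ a ∈ L.image Prod.fst, (a, f a) ∈ L

/-- With every hyperedge of which it contains an incidence, `L` contains all its incidences. -/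
def IsClosedIn (K L : Finset (ℕ × ℕ)) : Prop :=
  L ⊆ K ∧ ∀ a b a', (a, b) ∈ L → (a', b) ∈ K → (a', b) ∈ L

open Classical in
/-- A matching of the nodes of `L` that depends on `L` only. -/
noncomputable def canonicalMatching (L : Finset (ℕ × ℕ)) : ℕ → ℕ :=
  if h : ∃ f, IsMatchingOf L f then h.choose else id

theorem isMatchingOf_canonicalMatching {L : Finset (ℕ × ℕ)} (h : ∃ f, IsMatchingOf L f) :
    IsMatchingOf L (canonicalMatching L) := by
  rw [canonicalMatching, dif_pos h]
  exact h.choose_spec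

/-- `L` is a union of hyperedges that lies in a ball of radius `k`, whose nodes can be matched
to its hyperedges, and that contains the node `a`. -/
def IsCandidate (K : Finset (ℕ × ℕ)) (k a : ℕ) (L : Finset (ℕ × ℕ)) : Prop :=
  IsClosedIn K L ∧ (∃ f, IsMatchingOf L f) ∧ (∃ c, ∀ x ∈ L.image Prod.fst, Reach K k c x) ∧
    a ∈ L.image Prod.fst

/-- The node `a` is matched to the hyperedge `b` by its first candidate. -/
def Picks (K : Finset (ℕ × ℕ)) (k a b : ℕ) : Prop :=
  ∃ L, IsCandidate K k a L ∧
    (∀ L', IsCandidate K k a L' → Encodable.encode L ≤ Encodable.encode L') ∧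
    canonicalMatching L a = b

/-- The hyperedge `b` is outgoing for `a`: either `a` picks it, or no node picks it and `a` is
its first node. -/
def IsOutgoing (K : Finset (ℕ × ℕ)) (k a b : ℕ) : Prop :=
  (a, b) ∈ K ∧ (Picks K k a b ∨
    (∀ a', (a', b) ∈ K → ¬ Picks K k a' b) ∧ ∀ a', (a', b) ∈ K → a ≤ a')

theorem Picks.mem {K : Finset (ℕ × ℕ)} {k a b : ℕ} (h : Picks K k a b) : (a, b) ∈ K := by
  obtain ⟨L, hL, -, rfl⟩ := h
  exact hL.1.1 ((isMatchingOf_canonicalMatching hL.2.1).2 a hL.2.2.2)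

theorem Picks.unique {K : Finset (ℕ × ℕ)} {k a a' b : ℕ} (h : Picks K k a b)
    (h' : Picks K k a' b) : a = a' := by
  obtain ⟨L, hL, hmin, hb⟩ := h
  obtain ⟨L', hL', hmin', hb'⟩ := h'
  have hm := isMatchingOf_canonicalMatching hL.2.1
  have hm' := isMatchingOf_canonicalMatching hL'.2.1
  have h1 : (a, b) ∈ L := hb ▸ hm.2 a hL.2.2.2
  have h2 : (a', b) ∈ L' := hb' ▸ hm'.2 a' hL'.2.2.2
  have h3 : (a', b) ∈ L := hL.1.2 a b a' h1 (hL'.1.1 h2)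
  have h4 : (a, b) ∈ L' := hL'.1.2 a' b a h2 (hL.1.1 h1)
  -- The ball's center is existential in `IsCandidate`, so a candidate for one of its nodes is a
  -- candidate for all of them.
  have c3 : IsCandidate K k a' L := ⟨hL.1, hL.2.1, hL.2.2.1, mem_image_fst.2 ⟨b, h3⟩⟩
  have c4 : IsCandidate K k a L' := ⟨hL'.1, hL'.2.1, hL'.2.2.1, mem_image_fst.2 ⟨b, h4⟩⟩
  obtain rfl : L = L' := Encodable.encode_injective (le_antisymm (hmin _ c4) (hmin' _ c3))
  exact hm.1 (Finset.mem_coe.2 hL.2.2.2) (Finset.mem_coe.2 hL'.2.2.2) (hb.trans hb'.symm)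

theorem exists_picks {K : Finset (ℕ × ℕ)} {k a : ℕ} (h : ∃ L, IsCandidate K k a L) :
    ∃ b, Picks K k a b := by
  obtain ⟨L, hL, hmin⟩ := (measure (Encodable.encode : Finset (ℕ × ℕ) → ℕ)).wf.has_min
    {L | IsCandidate K k a L} h
  exact ⟨_, L, hL, fun L' hL' => not_lt.1 (hmin L' hL'), rfl⟩

theorem IsOutgoing.unique {K : Finset (ℕ × ℕ)} {k a a' b : ℕ} (h : IsOutgoing K k a b)
    (h' : IsOutgoing K k a' b) : a = a' := by
  obtain ⟨hm, h | ⟨h, hmin⟩⟩ := h <;> obtain ⟨hm', h' | ⟨h', hmin'⟩⟩ := h'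
  · exact h.unique h'
  · exact absurd h (h' a hm)
  · exact absurd h' (h a' hm')
  · exact le_antisymm (hmin a' hm') (hmin' a hm)

theorem exists_isOutgoing {K : Finset (ℕ × ℕ)} (k : ℕ) {b : ℕ} (h : ∃ a, (a, b) ∈ K) :
    ∃ a, IsOutgoing K k a b := by
  classical
  by_cases hp : ∃ a, Picks K k a b
  · obtain ⟨a, ha⟩ := hp
    exact ⟨a, ha.mem, Or.inl ha⟩
  · exact ⟨Nat.find h, Nat.find_spec h, Or.inr ⟨fun a' _ h' => hp ⟨a', h'⟩,
      fun a' h' => Nat.find_min' h h'⟩⟩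

/-! ### Locality of the orientation -/

/-- A candidate lies within `k` of its center and contains `a`, so its nodes are within `2k` of `a`.
Testing closedness looks one hyperedge further, whence `2k + 1`. -/
theorem isCandidate_congr {K K' : Finset (ℕ × ℕ)} {k a : ℕ} (hK : K ⊆ K')
    (hball : ∀ p ∈ K', Reach K' (2 * k + 1) a p.1 → p ∈ K) (L : Finset (ℕ × ℕ)) :
    IsCandidate K k a L ↔ IsCandidate K' k a L := by
  constructor
  · rintro ⟨⟨hLK, hcl⟩, hm, ⟨c, hc⟩, ha⟩
    refine ⟨⟨hLK.trans hK, fun x b y hx hy => hcl x b y hx (hball _ hy ?_)⟩, hm,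
      ⟨c, fun x hx => (hc x hx).mono_left hK⟩, ha⟩
    have h1 : Reach K' (k + k) a x := ((hc a ha).mono_left hK).symm.trans
      ((hc x (mem_image_fst.2 ⟨b, hx⟩)).mono_left hK)
    rw [two_mul]
    exact h1.trans (Near.reach (Or.inr ⟨b, hK (hLK hx), hy⟩))
  · rintro ⟨⟨hLK, hcl⟩, hm, ⟨c, hc⟩, ha⟩
    refine ⟨⟨fun p hp => hball p (hLK hp) ?_, fun x b y hx hy => hcl x b y hx (hK hy)⟩, hm,
      ⟨c, fun x hx => ?_⟩, ha⟩
    · exact ((hc a ha).symm.trans (hc p.1 (Finset.mem_image_of_mem _ hp))).mono (by omega)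
    · have key : ∀ j i y, i + j ≤ k → Reach K' i c y → Reach K' j y x → Reach K j y x := by
        intro j
        induction j with
        | zero => exact fun i y _ _ h => h
        | succ j ih =>
          rintro i y hij hcy ⟨z, hyz, hzx⟩
          have hcz : Reach K' (i + 1) c z := hcy.trans hyz.reach
          refine ⟨z, ?_, ih (i + 1) z (by omega) hcz hzx⟩
          rcases hyz with h | ⟨b, h1, h2⟩
          · exact Or.inl h
          · exact Or.inr ⟨b, hball _ h1 (((hc a ha).symm.trans hcy).mono (by omega)),
              hball _ h2 (((hc a ha).symm.trans hcz).mono (by omega))⟩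
      exact key k 0 c (by omega) rfl (hc x hx)

theorem picks_congr {K K' : Finset (ℕ × ℕ)} {k a : ℕ} (hK : K ⊆ K')
    (hball : ∀ p ∈ K', Reach K' (2 * k + 1) a p.1 → p ∈ K) (b : ℕ) :
    Picks K k a b ↔ Picks K' k a b := by
  simp only [Picks, isCandidate_congr hK hball]

/-- Whether a hyperedge is outgoing for a node depends only on the balls around its nodes. -/
theorem isOutgoing_congr {K K' : Finset (ℕ × ℕ)} {k b : ℕ} (hK : K ⊆ K')
    (hball : ∀ a, (a, b) ∈ K' → ∀ p ∈ K', Reach K' (2 * k + 1) a p.1 → p ∈ K) (a : ℕ) :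
    IsOutgoing K k a b ↔ IsOutgoing K' k a b := by
  have hmem : ∀ x, (x, b) ∈ K ↔ (x, b) ∈ K' :=
    fun x => ⟨fun h => hK h, fun h => hball x h _ h (Reach.refl _ _ _)⟩
  have hpick : ∀ x, (x, b) ∈ K' → (Picks K k x b ↔ Picks K' k x b) :=
    fun x hx => picks_congr hK (hball x hx) b
  simp only [IsOutgoing, hmem]
  refine and_congr_right fun ha => or_congr (hpick a ha) (and_congr_left fun _ => ?_)
  exact forall₂_congr fun x hx => not_congr (hpick x hx)

/-! ### Existence of candidates -/

/-- If a set of hyperedges has at most as many nodes outside `S` as it has members, then the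
nodes outside `S` of some nonempty subset can be matched to its members. -/
theorem exists_subset_matching (K : Finset (ℕ × ℕ)) (S : Finset ℕ) {F : Finset ℕ}
    (hF : F.Nonempty) (hcard : (incidentNodes K F \ S).card ≤ F.card) :
    ∃ F' ⊆ F, F'.Nonempty ∧ ∃ f : ℕ → ℕ, Set.InjOn f ↑(incidentNodes K F' \ S) ∧
      ∀ a ∈ incidentNodes K F' \ S, f a ∈ F' ∧ (a, f a) ∈ K := by
  classical
  induction F using Finset.strongInduction with
  | H F ih =>
  let t : ↥(incidentNodes K F \ S) → Finset ℕ := fun x => F.filter fun b => (x.1, b) ∈ K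
  by_cases hall : ∀ s : Finset ↥(incidentNodes K F \ S), s.card ≤ (s.biUnion t).card
  · obtain ⟨f, hinj, hf⟩ := (Finset.all_card_le_biUnion_card_iff_exists_injective t).1 hall
    refine ⟨F, subset_rfl, hF, fun a => if h : a ∈ incidentNodes K F \ S then f ⟨a, h⟩ else 0,
      ?_, ?_⟩
    · intro x hx y hy hxy
      rw [Finset.mem_coe] at hx hy
      simp only [dif_pos hx, dif_pos hy] at hxy
      exact congrArg Subtype.val (hinj hxy)
    · intro a ha
      simp only [dif_pos ha]
      simpa [t] using hf ⟨a, ha⟩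
  · push Not at hall
    obtain ⟨s, hs⟩ := hall
    -- Discard a Hall violator `s` with its hyperedges `B`. As `|B| < |s|`, more nodes than
    -- hyperedges are lost, so the hypothesis passes to `F \ B`, which is nonempty because `|s| ≤
    -- |F|`.
    set B := s.biUnion t with hB
    have hBF : B ⊆ F := by
      intro b hb
      obtain ⟨x, -, hx⟩ := Finset.mem_biUnion.1 hb
      exact (Finset.mem_filter.1 hx).1
    have hsle : s.card ≤ (incidentNodes K F \ S).card := by
      simpa using Finset.card_le_univ s
    have hsne : s.Nonempty := Finset.card_pos.1 (by omega)
    have hBne : B.Nonempty := by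
      obtain ⟨x, hx⟩ := hsne
      obtain ⟨b, hb, hxb⟩ := mem_incidentNodes.1 (Finset.mem_sdiff.1 x.2).1
      exact ⟨b, Finset.mem_biUnion.2 ⟨x, hx, Finset.mem_filter.2 ⟨hb, hxb⟩⟩⟩
    have hcF : (F \ B).card = F.card - B.card := Finset.card_sdiff_of_subset hBF
    have hsub : incidentNodes K (F \ B) \ S ⊆
        (incidentNodes K F \ S) \ s.image Subtype.val := by
      intro x hx
      obtain ⟨hx1, hxS⟩ := Finset.mem_sdiff.1 hx
      obtain ⟨b, hb, hxb⟩ := mem_incidentNodes.1 hx1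
      obtain ⟨hbF, hbB⟩ := Finset.mem_sdiff.1 hb
      refine Finset.mem_sdiff.2 ⟨Finset.mem_sdiff.2 ⟨mem_incidentNodes.2 ⟨b, hbF, hxb⟩, hxS⟩, ?_⟩
      intro hxs
      obtain ⟨y, hy, rfl⟩ := Finset.mem_image.1 hxs
      exact hbB (Finset.mem_biUnion.2 ⟨y, hy, Finset.mem_filter.2 ⟨hbF, hxb⟩⟩)
    have himg : s.image Subtype.val ⊆ incidentNodes K F \ S := by
      intro x hx
      obtain ⟨y, -, rfl⟩ := Finset.mem_image.1 hx
      exact y.2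
    have hcs : (s.image Subtype.val).card = s.card :=
      Finset.card_image_of_injective _ Subtype.val_injective
    have hcN := Finset.card_le_card hsub
    rw [Finset.card_sdiff_of_subset himg, hcs] at hcN
    obtain ⟨F', hF', h⟩ := ih (F \ B) (Finset.sdiff_ssubset hBF hBne)
      (Finset.card_pos.1 (by omega)) (by omega)
    exact ⟨F', hF'.trans Finset.sdiff_subset, h⟩

/-- The two matchings can be glued because the hyperedges of `F` do not occur in `L`, so their
values never collide. -/
theorem IsMatchingOf.extend {K L : Finset (ℕ × ℕ)} {F : Finset ℕ} {g f : ℕ → ℕ}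
    (hg : IsMatchingOf L g) (hdisj : ∀ b ∈ F, b ∉ L.image Prod.snd)
    (hinj : Set.InjOn f ↑(incidentNodes K F \ L.image Prod.fst))
    (hf : ∀ a ∈ incidentNodes K F \ L.image Prod.fst, f a ∈ F ∧ (a, f a) ∈ K) :
    ∃ h, IsMatchingOf (L ∪ K.filter fun p => p.2 ∈ F) h := by
  classical
  have hnodes : ∀ x ∈ (L ∪ K.filter fun p => p.2 ∈ F).image Prod.fst,
      x ∉ L.image Prod.fst → x ∈ incidentNodes K F \ L.image Prod.fst := by
    intro x hx hxL
    rw [Finset.image_union, Finset.mem_union] at hx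
    exact Finset.mem_sdiff.2 ⟨hx.resolve_left hxL, hxL⟩
  have hne : ∀ x y, x ∈ L.image Prod.fst → y ∈ incidentNodes K F \ L.image Prod.fst →
      g x ≠ f y := by
    intro x y hx hy h
    exact hdisj _ (hf y hy).1 (h ▸ mem_image_snd.2 ⟨x, hg.2 x hx⟩)
  refine ⟨fun x => if x ∈ L.image Prod.fst then g x else f x, ?_, ?_⟩
  · intro x hx y hy hxy
    rw [Finset.mem_coe] at hx hy
    by_cases hxL : x ∈ L.image Prod.fst <;> by_cases hyL : y ∈ L.image Prod.fst <;>
      simp only [hxL, hyL, if_true, if_false] at hxy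
    · exact hg.1 hxL hyL hxy
    · exact absurd hxy (hne x y hxL (hnodes y hy hyL))
    · exact absurd hxy.symm (hne y x hyL (hnodes x hx hxL))
    · exact hinj (Finset.mem_coe.2 (hnodes x hx hxL)) (Finset.mem_coe.2 (hnodes y hy hyL)) hxy
  · intro x hx
    by_cases hxL : x ∈ L.image Prod.fst
    · simp only [hxL, if_true]
      exact Finset.mem_union_left _ (hg.2 x hxL)
    · simp only [hxL, if_false]
      obtain ⟨h1, h2⟩ := hf x (hnodes x hx hxL)
      exact Finset.mem_union_right _ (Finset.mem_filter.2 ⟨h2, h1⟩)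

/-- A largest matchable union of hyperedges in the ball around `a` leaves a hypergraph in which
every set of hyperedges in the ball has more nodes than members. -/
theorem exists_maximal_closed (K : Finset (ℕ × ℕ)) (k a : ℕ) :
    ∃ L, IsClosedIn K L ∧ (∃ f, IsMatchingOf L f) ∧ (∀ x ∈ L.image Prod.fst, Reach K k a x) ∧
      ∀ F : Finset ℕ, F.Nonempty → F ⊆ K.image Prod.snd → (∀ b ∈ F, b ∉ L.image Prod.snd) →
        (∀ x ∈ incidentNodes K F, Reach K k a x) →
        F.card < (incidentNodes K F \ L.image Prod.fst).card := by
  classical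
  let P : Finset (ℕ × ℕ) → Prop := fun L => IsClosedIn K L ∧ (∃ f, IsMatchingOf L f) ∧
    ∀ x ∈ L.image Prod.fst, Reach K k a x
  have hempty : P ∅ := by
    refine ⟨⟨Finset.empty_subset _, ?_⟩, ⟨id, ?_, ?_⟩, ?_⟩ <;> simp
  obtain ⟨L, hL, hmax⟩ := Finset.exists_max_image (K.powerset.filter P) Finset.card
    ⟨∅, Finset.mem_filter.2 ⟨Finset.mem_powerset.2 (Finset.empty_subset _), hempty⟩⟩
  obtain ⟨-, hcl, ⟨g, hg⟩, hreach⟩ := Finset.mem_filter.1 hL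
  refine ⟨L, hcl, ⟨g, hg⟩, hreach, fun F hF hFK hdisj hFr => ?_⟩
  by_contra hcard
  obtain ⟨F', hF'F, ⟨b, hb⟩, f, hinj, hf⟩ :=
    exists_subset_matching K (L.image Prod.fst) hF (not_lt.1 hcard)
  set L' := L ∪ K.filter fun p => p.2 ∈ F' with hL'
  have hsub : L' ⊆ K := Finset.union_subset hcl.1 (Finset.filter_subset _ _)
  have hP : P L' := by
    refine ⟨⟨hsub, fun x y z hx hz => ?_⟩,
      hg.extend (fun b hb => hdisj b (hF'F hb)) hinj hf, fun x hx => ?_⟩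
    · rcases Finset.mem_union.1 hx with hx | hx
      · exact Finset.mem_union_left _ (hcl.2 x y z hx hz)
      · exact Finset.mem_union_right _
          (Finset.mem_filter.2 ⟨hz, (Finset.mem_filter.1 hx).2⟩)
    · obtain ⟨y, hy⟩ := mem_image_fst.1 hx
      rcases Finset.mem_union.1 hy with hy | hy
      · exact hreach x (mem_image_fst.2 ⟨y, hy⟩)
      · obtain ⟨h1, h2⟩ := Finset.mem_filter.1 hy
        exact hFr x (mem_incidentNodes.2 ⟨y, hF'F h2, h1⟩)
  obtain ⟨x, hx⟩ := mem_image_snd.1 (hFK (hF'F hb))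
  have hlt : L ⊂ L' := by
    refine Finset.ssubset_iff_of_subset Finset.subset_union_left |>.2
      ⟨(x, b), Finset.mem_union_right _ (Finset.mem_filter.2 ⟨hx, hb⟩), fun h => ?_⟩
    exact hdisj b (hF'F hb) (mem_image_snd.2 ⟨x, h⟩)
  have := hmax L' (Finset.mem_filter.2 ⟨Finset.mem_powerset.2 hsub, hP⟩)
  exact absurd (Finset.card_lt_card hlt) (not_lt.2 this)

theorem exists_isCandidate {K : Finset (ℕ × ℕ)} {n δ r k a : ℕ}
    (hδ : ∀ x ∈ K.image Prod.fst, δ ≤ ((K.image Prod.snd).filter fun b => (x, b) ∈ K).card)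
    (hr : ∀ b, ((K.image Prod.fst).filter fun x => (x, b) ∈ K).card ≤ r)
    (hn : (K.image Prod.fst).card ≤ n) (hk : r ^ k * n < δ ^ k) (ha : a ∈ K.image Prod.fst) :
    ∃ L, IsCandidate K k a L := by
  classical
  obtain ⟨L, hcl, hm, hreach, hexp⟩ := exists_maximal_closed K k a
  refine ⟨L, hcl, hm, ⟨a, hreach⟩, ?_⟩
  by_contra haL
  -- Expansion by `δ / r` per step, with denominators cleared to stay in `ℕ`.
  have grow : ∀ j ≤ k, ∃ W ⊆ K.image Prod.fst, W.Nonempty ∧ Disjoint W (L.image Prod.fst) ∧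
      (∀ x ∈ W, Reach K j a x) ∧ δ ^ j ≤ r ^ j * W.card := by
    intro j
    induction j with
    | zero =>
      intro _
      refine ⟨{a}, Finset.singleton_subset_iff.2 ha, Finset.singleton_nonempty a,
        Finset.disjoint_singleton_left.2 haL, fun x hx => (Finset.mem_singleton.1 hx).symm, ?_⟩
      simp
    | succ j ih =>
      intro hj
      obtain ⟨W, hWK, ⟨w, hw⟩, hWL, hWr, hWc⟩ := ih (by omega)
      have hFne : (incidentEdges K W).Nonempty := by
        obtain ⟨b, hb⟩ := mem_image_fst.1 (hWK hw)
        exact ⟨b, mem_incidentEdges.2 ⟨w, hw, hb⟩⟩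
      have hFr : ∀ x ∈ incidentNodes K (incidentEdges K W), Reach K (j + 1) a x := by
        intro x hx
        obtain ⟨b, hb, hxb⟩ := mem_incidentNodes.1 hx
        obtain ⟨y, hy, hyb⟩ := mem_incidentEdges.1 hb
        exact (hWr y hy).trans (Near.reach (Or.inr ⟨b, hyb, hxb⟩))
      have hlt := hexp (incidentEdges K W) hFne
        (fun b hb => by
          obtain ⟨y, -, hyb⟩ := mem_incidentEdges.1 hb
          exact mem_image_snd.2 ⟨y, hyb⟩)
        (fun b hb hbL => by
          obtain ⟨y, hy, hyb⟩ := mem_incidentEdges.1 hb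
          obtain ⟨x, hx⟩ := mem_image_snd.1 hbL
          exact Finset.disjoint_left.1 hWL hy (mem_image_fst.2 ⟨b, hcl.2 x b y hx hyb⟩))
        (fun x hx => (hFr x hx).mono hj)
      -- Double counting of the incidences between `W` and its hyperedges.
      have hdc : W.card * δ ≤ (incidentEdges K W).card * r := by
        refine Finset.card_mul_le_card_mul (fun x b => (x, b) ∈ K) (fun x hx => ?_) (fun b _ => ?_)
        · refine (hδ x (hWK hx)).trans (Finset.card_le_card fun b hb => ?_)
          have hxb := (Finset.mem_filter.1 hb).2
          exact Finset.mem_filter.2 ⟨mem_incidentEdges.2 ⟨x, hx, hxb⟩, hxb⟩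
        · refine (Finset.card_le_card ?_).trans (hr b)
          exact Finset.filter_subset_filter _ hWK
      refine ⟨incidentNodes K (incidentEdges K W) \ L.image Prod.fst, fun x hx => ?_,
        Finset.card_pos.1 (by omega), Finset.sdiff_disjoint,
        fun x hx => hFr x (Finset.mem_sdiff.1 hx).1, ?_⟩
      · obtain ⟨b, -, hb⟩ := mem_incidentNodes.1 (Finset.mem_sdiff.1 hx).1
        exact mem_image_fst.2 ⟨b, hb⟩
      · calc δ ^ (j + 1) = δ ^ j * δ := pow_succ _ _
          _ ≤ (r ^ j * W.card) * δ := Nat.mul_le_mul_right _ hWc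
          _ = r ^ j * (W.card * δ) := by ring
          _ ≤ r ^ j * ((incidentEdges K W).card * r) := Nat.mul_le_mul_left _ hdc
          _ = r ^ (j + 1) * (incidentEdges K W).card := by ring
          _ ≤ _ := Nat.mul_le_mul_left _ hlt.le
  obtain ⟨W, hWK, -, -, -, hWc⟩ := grow k le_rfl
  have : r ^ k * W.card ≤ r ^ k * n :=
    Nat.mul_le_mul_left _ ((Finset.card_le_card hWK).trans hn)
  omega

/-! ### Search radius -/

/-- The radius of the balls in which the nodes look for a candidate. -/
noncomputable def searchRadius (n δ r : ℕ) : ℕ :=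
  ⌊Real.logb ((δ : ℝ) / (r : ℝ)) (n : ℝ)⌋₊ + 1

theorem pow_searchRadius {n δ r : ℕ} (hn : 1 ≤ n) (hr : 1 ≤ r) (h : r < δ) :
    r ^ searchRadius n δ r * n < δ ^ searchRadius n δ r := by
  have hr0 : (0 : ℝ) < r := by exact_mod_cast hr
  have hb : (1 : ℝ) < (δ : ℝ) / r := by
    rw [one_lt_div hr0]
    exact_mod_cast h
  have hn0 : (0 : ℝ) < n := by exact_mod_cast hn
  have h1 : Real.logb ((δ : ℝ) / r) n < (searchRadius n δ r : ℝ) := by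
    rw [searchRadius]
    push_cast
    exact Nat.lt_floor_add_one _
  rw [Real.logb_lt_iff_lt_rpow hb hn0, Real.rpow_natCast, div_pow,
    lt_div_iff₀ (pow_pos hr0 _), mul_comm] at h1
  exact_mod_cast h1

/-! ### The gathering algorithm -/

/-- What a node of the bipartite representation knows while it gathers its neighborhood: the
incidences that it has heard of, and the identifiers of its neighbors. -/
structure GatherState where
  ident : ℕ
  input : HypergraphInput
  known : Finset (ℕ × ℕ)
  neighbor : ℕ → ℕ

/-- An incidence, from the point of view of a node or of a hyperedge. -/
def orientPair (isVertex : Bool) (x y : ℕ) : ℕ × ℕ :=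
  if isVertex then (x, y) else (y, x)

open Classical in
/-- Gather all incidences in the neighborhood, and compute the orientation from them. -/
noncomputable def gatherAlgorithm : LocalAlgorithm HypergraphInput Bool where
  State := GatherState
  Msg := ℕ × Finset (ℕ × ℕ)
  start _ ident inp := ⟨ident, inp, ∅, fun _ => 0⟩
  send _ s _ := (s.ident, s.known)
  receive d s m :=
    { s with
      known := s.known ∪ Finset.univ.biUnion fun i : Fin d =>
        insert (orientPair s.input.isVertex s.ident (m i).1) (m i).2
      neighbor := fun j => if h : j < d then (m ⟨j, h⟩).1 else 0 }
  output _ s i :=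
    let p := orientPair s.input.isVertex s.ident (s.neighbor i)
    decide (IsOutgoing s.known
      (searchRadius s.input.numNodes s.input.minDegree s.input.maxRank) p.1 p.2)

section Gather

variable {W : Type*} {H : SimpleGraph W} (P : PortNumbering H) (ident : W → ℕ)
  (inp : W → HypergraphInput)

/-- The state of the gathering algorithm. -/
noncomputable def gatherState (t : ℕ) (w : W) : GatherState :=
  gatherAlgorithm.stateAfter P ident inp t w

theorem gatherState_ident (t : ℕ) (w : W) : (gatherState P ident inp t w).ident = ident w := by
  induction t with
  | zero => rfl
  | succ t ih => exact ih

theorem gatherState_input (t : ℕ) (w : W) : (gatherState P ident inp t w).input = inp w := by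
  induction t with
  | zero => rfl
  | succ t ih => exact ih

theorem gatherState_known_succ (t : ℕ) (w : W) :
    (gatherState P ident inp (t + 1) w).known = (gatherState P ident inp t w).known ∪
      Finset.univ.biUnion fun i : Fin (P.deg w) =>
        insert (orientPair (inp w).isVertex (ident w) (ident (P.port w i)))
          (gatherState P ident inp t (P.port w i)).known := by
  rw [← gatherState_ident P ident inp t w, ← gatherState_input P ident inp t w]
  simp only [← gatherState_ident P ident inp t (P.port w _)]
  rfl

theorem gatherState_neighbor (t : ℕ) {w u : W} (h : H.Adj w u) :
    (gatherState P ident inp (t + 1) w).neighbor ((P.port w).symm ⟨u, h⟩ : Fin (P.deg w)) =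
      ident u := by
  have : (gatherState P ident inp (t + 1) w).neighbor ((P.port w).symm ⟨u, h⟩ : Fin (P.deg w)) =
      (gatherState P ident inp t (P.port w ((P.port w).symm ⟨u, h⟩))).ident := by
    change (if _ : _ then _ else _) = _
    rw [dif_pos ((P.port w).symm ⟨u, h⟩).2]
    rfl
  rw [this, gatherState_ident, Equiv.apply_symm_apply]

theorem known_subset_succ (t : ℕ) (w : W) :
    (gatherState P ident inp t w).known ⊆ (gatherState P ident inp (t + 1) w).known := by
  rw [gatherState_known_succ]
  exact Finset.subset_union_left

theorem insert_known_subset_succ (t : ℕ) {w u : W} (h : H.Adj w u) :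
    insert (orientPair (inp w).isVertex (ident w) (ident u))
      (gatherState P ident inp t u).known ⊆ (gatherState P ident inp (t + 1) w).known := by
  rw [gatherState_known_succ]
  refine subset_trans ?_ Finset.subset_union_right
  have := Finset.subset_biUnion_of_mem (fun i : Fin (P.deg w) =>
    insert (orientPair (inp w).isVertex (ident w) (ident (P.port w i)))
      (gatherState P ident inp t (P.port w i)).known)
    (Finset.mem_univ ((P.port w).symm ⟨u, h⟩))
  simpa only [Equiv.apply_symm_apply] using this

theorem known_subset_succ_of_adj (t : ℕ) {w u : W} (h : H.Adj w u) :
    (gatherState P ident inp t u).known ⊆ (gatherState P ident inp (t + 1) w).known :=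
  (Finset.subset_insert _ _).trans (insert_known_subset_succ P ident inp t h)

theorem gather_output (t : ℕ) {w u : W} (h : H.Adj w u) :
    gatherAlgorithm.outputAfter P ident inp (t + 1) w u h = true ↔
      IsOutgoing (gatherState P ident inp (t + 1) w).known
        (searchRadius (inp w).numNodes (inp w).minDegree (inp w).maxRank)
        (orientPair (inp w).isVertex (ident w) (ident u)).1
        (orientPair (inp w).isVertex (ident w) (ident u)).2 := by
  rw [← gatherState_neighbor P ident inp t h, ← gatherState_ident P ident inp (t + 1) w,
    ← gatherState_input P ident inp (t + 1) w]
  exact @decide_eq_true_iff _ (Classical.propDecidable _)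

end Gather

/-! ### From hypergraphs to incidence sets -/

namespace MultiHypergraph

variable {V E : Type*} [Finite V] [Finite E] (G : MultiHypergraph V E) (ident : V ⊕ E → ℕ)

/-- The incidences of a hypergraph, as pairs of identifiers. -/
noncomputable def incidences : Finset (ℕ × ℕ) :=
  (Set.toFinite ((fun q : V × E => (ident (.inl q.1), ident (.inr q.2))) ''
    {q | q.1 ∈ G.ends q.2})).toFinset

theorem mem_incidences {p : ℕ × ℕ} : p ∈ G.incidences ident ↔
    ∃ v e, v ∈ G.ends e ∧ p = (ident (.inl v), ident (.inr e)) := by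
  simp only [incidences, Set.Finite.mem_toFinset, Set.mem_image, Set.mem_ofPred_eq, Prod.exists]
  exact exists₂_congr fun v e => and_congr_right fun _ => eq_comm

variable {G ident}

theorem ident_mem_incidences (hid : Function.Injective ident) {v : V} {e : E} :
    (ident (.inl v), ident (.inr e)) ∈ G.incidences ident ↔ v ∈ G.ends e := by
  rw [mem_incidences]
  constructor
  · rintro ⟨v', e', h, heq⟩
    obtain ⟨h1, h2⟩ := Prod.mk.inj heq
    obtain rfl := Sum.inl_injective (hid h1)
    obtain rfl := Sum.inr_injective (hid h2)
    exact h
  · exact fun h => ⟨v, e, h, rfl⟩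

theorem incidences_nodes_card : ((G.incidences ident).image Prod.fst).card ≤ Nat.card V := by
  classical
  have := Fintype.ofFinite V
  rw [Nat.card_eq_fintype_card, ← Finset.card_univ]
  refine (Finset.card_le_card ?_).trans
    (Finset.card_image_le (s := Finset.univ) (f := fun v : V => ident (.inl v)))
  intro a ha
  obtain ⟨b, hb⟩ := mem_image_fst.1 ha
  obtain ⟨v, e, -, h⟩ := (mem_incidences G ident).1 hb
  exact Finset.mem_image.2 ⟨v, Finset.mem_univ _, (Prod.mk.inj h).1.symm⟩

theorem le_incidences_degree (hid : Function.Injective ident) {δ : ℕ}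
    (hδ : ∀ v, δ ≤ G.degree v) : ∀ x ∈ (G.incidences ident).image Prod.fst,
      δ ≤ (((G.incidences ident).image Prod.snd).filter
        fun b => (x, b) ∈ G.incidences ident).card := by
  intro x hx
  obtain ⟨b, hb⟩ := mem_image_fst.1 hx
  obtain ⟨v, e, -, h⟩ := (mem_incidences G ident).1 hb
  obtain ⟨rfl, -⟩ := Prod.mk.inj h
  refine (hδ v).trans ?_
  rw [degree, ← Set.ncard_coe_finset]
  refine Set.ncard_le_ncard_of_injOn (fun e => ident (.inr e)) (fun e he => ?_)
    (fun e _ e' _ h => Sum.inr_injective (hid h)) (Finset.finite_toSet _)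
  have he' := (ident_mem_incidences hid).2 he
  exact Finset.mem_coe.2 (Finset.mem_filter.2 ⟨mem_image_snd.2 ⟨_, he'⟩, he'⟩)

theorem incidences_rank_le (hid : Function.Injective ident) {r : ℕ}
    (hr : ∀ e, G.rank e ≤ r) (b : ℕ) :
    (((G.incidences ident).image Prod.fst).filter
      fun x => (x, b) ∈ G.incidences ident).card ≤ r := by
  classical
  by_cases h : ∃ e, ident (.inr e) = b
  · obtain ⟨e, rfl⟩ := h
    refine le_trans ?_ (hr e)
    refine (Finset.card_le_card ?_).trans
      (Finset.card_image_le (s := G.ends e) (f := fun v : V => ident (.inl v)))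
    intro x hx
    have hx := (Finset.mem_filter.1 hx).2
    obtain ⟨v, e', -, h⟩ := (mem_incidences G ident).1 hx
    obtain ⟨rfl, -⟩ := Prod.mk.inj h
    exact Finset.mem_image_of_mem _ ((ident_mem_incidences hid).1 hx)
  · rw [Finset.card_eq_zero.2]
    · exact Nat.zero_le _
    · refine Finset.filter_eq_empty_iff.2 fun x _ hx => h ?_
      obtain ⟨v, e, -, h⟩ := (mem_incidences G ident).1 hx
      exact ⟨e, (Prod.mk.inj h).2.symm⟩

variable (P : PortNumbering G.bipartite) {inp : V ⊕ E → HypergraphInput}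

theorem orientPair_mem_incidences (hinp : ∀ w, (inp w).isVertex = w.isLeft) {w u : V ⊕ E}
    (h : G.bipartite.Adj w u) :
    orientPair (inp w).isVertex (ident w) (ident u) ∈ G.incidences ident := by
  rw [mem_incidences, hinp]
  rcases h with ⟨v, e, rfl, rfl, h⟩ | ⟨v, e, rfl, rfl, h⟩ <;>
    exact ⟨v, e, h, by simp [orientPair]⟩

theorem known_subset_incidences (hinp : ∀ w, (inp w).isVertex = w.isLeft) (t : ℕ) (w : V ⊕ E) :
    (gatherState P ident inp t w).known ⊆ G.incidences ident := by
  induction t generalizing w with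
  | zero => exact Finset.empty_subset _
  | succ t ih =>
    rw [gatherState_known_succ]
    refine Finset.union_subset (ih w) (Finset.biUnion_subset.2 fun i _ =>
      Finset.insert_subset (orientPair_mem_incidences hinp (P.port w i).2) (ih _))

/-- One round reveals a node's own incidences; each hyperedge crossed is two bipartite edges, hence
two further rounds. -/
theorem mem_known_of_reach (hid : Function.Injective ident)
    (hinp : ∀ w, (inp w).isVertex = w.isLeft) (j : ℕ) (v : V) {p : ℕ × ℕ}
    (hp : p ∈ G.incidences ident) (h : Reach (G.incidences ident) j (ident (.inl v)) p.1) :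
    p ∈ (gatherState P ident inp (2 * j + 1) (.inl v)).known := by
  induction j generalizing v with
  | zero =>
    obtain ⟨v', e, hv, rfl⟩ := (mem_incidences G ident).1 hp
    obtain rfl := Sum.inl_injective (hid h)
    refine insert_known_subset_succ P ident inp 0 (G.bipartite_adj hv)
      (Finset.mem_insert.2 (Or.inl ?_))
    simp [hinp, orientPair]
  | succ j ih =>
    obtain ⟨z, hz | ⟨b, hb, hb'⟩, hreach⟩ := h
    · subst hz
      exact known_subset_succ _ _ _ _ _ (known_subset_succ _ _ _ _ _ (ih v hreach))
    · obtain ⟨v', e, hv', heq⟩ := (mem_incidences G ident).1 hb'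
      obtain ⟨rfl, rfl⟩ := Prod.mk.inj heq
      have hv := (ident_mem_incidences hid).1 hb
      exact known_subset_succ_of_adj P ident inp _ (G.bipartite_adj hv)
        (known_subset_succ_of_adj P ident inp _ (G.bipartite_adj hv').symm (ih v' hreach))

/-- After enough rounds, both the members of a hyperedge and the hyperedge itself know the balls
around all nodes of the hyperedge. -/
theorem isOutgoing_known (hid : Function.Injective ident)
    (hinp : ∀ w, (inp w).isVertex = w.isLeft) (k : ℕ) {v : V} {e : E} (hv : v ∈ G.ends e)
    {w : V ⊕ E} (hw : w = .inl v ∨ w = .inr e) (a : ℕ) :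
    IsOutgoing (gatherState P ident inp (4 * k + 5) w).known k a (ident (.inr e)) ↔
      IsOutgoing (G.incidences ident) k a (ident (.inr e)) := by
  refine isOutgoing_congr (known_subset_incidences P hinp _ w) (fun x hx p hp hreach => ?_) a
  obtain ⟨v', e', -, heq⟩ := (mem_incidences G ident).1 hx
  obtain ⟨rfl, -⟩ := Prod.mk.inj heq
  have hv' := (ident_mem_incidences hid).1 hx
  have h1 := mem_known_of_reach P hid hinp _ v' hp hreach
  have h2 := known_subset_succ_of_adj P ident inp _ (G.bipartite_adj hv').symm h1
  -- Gathering radius `2k + 1` takes `4k + 3` rounds; one more informs the hyperedge, and another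
  -- its members.
  have hT : 2 * (2 * k + 1) + 1 + 1 + 1 = 4 * k + 5 := by ring
  rcases hw with rfl | rfl
  · have h3 := known_subset_succ_of_adj P ident inp _ (G.bipartite_adj hv) h2
    rwa [hT] at h3
  · have h3 := known_subset_succ P ident inp _ _ h2
    rwa [hT] at h3

end MultiHypergraph

/-! ### Correctness and running time -/

/-- The gathering algorithm computes a hypergraph sinkless orientation. -/
theorem gatherAlgorithm_computesHSO {n δ r : ℕ} (hn : 1 ≤ n) (hr : 1 ≤ r) (hrδ : r < δ)
    {V E : Type*} [Finite V] [Finite E] (G : MultiHypergraph V E) (hV : Nat.card V = n)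
    (hδ : ∀ v, δ ≤ G.degree v) (hrank : ∀ e, G.rank e ≤ r) (P : PortNumbering G.bipartite)
    (ident : V ⊕ E → ℕ) (hid : Function.Injective ident) :
    gatherAlgorithm.ComputesHSO G n δ r (4 * searchRadius n δ r + 5) P ident := by
  set k := searchRadius n δ r with hk
  have hex : ∀ e : E, ∃ v, IsOutgoing (G.incidences ident) k (ident (.inl v))
      (ident (.inr e)) := by
    intro e
    obtain ⟨v, hv⟩ := G.ends_nonempty e
    obtain ⟨a, ha⟩ := exists_isOutgoing k ⟨_, (MultiHypergraph.ident_mem_incidences hid).2 hv⟩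
    obtain ⟨v', e', -, heq⟩ := (MultiHypergraph.mem_incidences G ident).1 ha.1
    obtain ⟨rfl, -⟩ := Prod.mk.inj heq
    exact ⟨v', ha⟩
  choose out hout using hex
  have hiff : ∀ v e, IsOutgoing (G.incidences ident) k (ident (.inl v)) (ident (.inr e)) ↔
      out e = v :=
    fun v e => ⟨fun h => Sum.inl_injective (hid ((hout e).unique h)), fun h => h ▸ hout e⟩
  refine ⟨out, ⟨fun e => (MultiHypergraph.ident_mem_incidences hid).1 (hout e).1, fun v => ?_⟩,
    fun v e h => ⟨?_, ?_⟩⟩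
  -- Only nodes lying in some hyperedge occur in the incidence set.
  · have hpos : 0 < G.degree v := by have := hδ v; omega
    obtain ⟨e, he⟩ := Set.nonempty_of_ncard_ne_zero hpos.ne'
    have hcand : ∃ L, IsCandidate (G.incidences ident) k (ident (.inl v)) L :=
      exists_isCandidate (MultiHypergraph.le_incidences_degree hid hδ)
        (MultiHypergraph.incidences_rank_le hid hrank)
        (hV ▸ MultiHypergraph.incidences_nodes_card) (pow_searchRadius hn hr hrδ)
        (mem_image_fst.2 ⟨_, (MultiHypergraph.ident_mem_incidences hid).2 he⟩)
    obtain ⟨b, hb⟩ := exists_picks hcand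
    obtain ⟨v', e', -, heq⟩ := (MultiHypergraph.mem_incidences G ident).1 hb.mem
    obtain ⟨-, rfl⟩ := Prod.mk.inj heq
    exact ⟨e', (hiff v e').1 ⟨hb.mem, Or.inl hb⟩⟩
  · rw [← hiff, ← MultiHypergraph.isOutgoing_known P
      (inp := fun w => ⟨n, δ, r, w.isLeft⟩) hid (fun w => rfl) k h (Or.inl rfl)]
    exact gather_output P ident _ _ _
  · rw [← hiff, ← MultiHypergraph.isOutgoing_known P
      (inp := fun w => ⟨n, δ, r, w.isLeft⟩) hid (fun w => rfl) k h (Or.inr rfl)]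
    exact gather_output P ident _ _ _

theorem theorem1p6 :
    ∃ (C : ℝ) (A : LocalAlgorithm HypergraphInput Bool) (T : ℕ → ℕ → ℕ → ℕ),
      ∀ n δ r : ℕ, 1 ≤ n → 1 ≤ r → r < δ →
        (T n δ r : ℝ) ≤ C * max 1 (Real.logb ((δ : ℝ) / (r : ℝ)) (n : ℝ)) ∧
        ∀ (V E : Type*) [Finite V] [Finite E] (G : MultiHypergraph V E),
          Nat.card V = n → (∀ v, δ ≤ G.degree v) → (∀ e, G.rank e ≤ r) →
          ∀ (P : PortNumbering G.bipartite) (ident : V ⊕ E → ℕ), Function.Injective ident →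
            A.ComputesHSO G n δ r (T n δ r) P ident := by
  -- The radius is at most `log + 1`, so `4 * (log + 1) + 5 = 4 * log + 9 ≤ 13 * max 1 log`.
  refine ⟨13, gatherAlgorithm, fun n δ r => 4 * searchRadius n δ r + 5,
    fun n δ r hn hr hrδ => ⟨?_, fun V E _ _ G hV hδ hrank P ident hid =>
      gatherAlgorithm_computesHSO hn hr hrδ G hV hδ hrank P ident hid⟩⟩
  have hr0 : (0 : ℝ) < r := by exact_mod_cast hr
  have hb : (1 : ℝ) < (δ : ℝ) / r := by
    rw [one_lt_div hr0]
    exact_mod_cast hrδ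
  have hlog : 0 ≤ Real.logb ((δ : ℝ) / r) n := Real.logb_nonneg hb (by exact_mod_cast hn)
  have hfloor := Nat.floor_le hlog
  have h1 := le_max_left 1 (Real.logb ((δ : ℝ) / r) n)
  have h2 := le_max_right 1 (Real.logb ((δ : ℝ) / r) n)
  simp only [searchRadius]
  push_cast
  linarith
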